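/- \textbf{Lemma (Distributional properties).} Let $m_1,m_2\ge 1$ and $0\le R<\min(m_1,m_2)$ be integers and let $\sigma>0$. Let $U\in\mathbb{R}^{m_1\times R}$ and $V\in\mathbb{R}^{m_2\times R}$ have orthonormal columns, let $P_U=UU^T$ and $P_V=VV^T$, and let $\mathcal{U}\subseteq\mathbb{R}^{m_1}$, $\mathcal{V}\subseteq\mathbb{R}^{m_2}$ be the images of $P_U$, $P_V$. Let $X$ be a random $m_1\times m_2$ matrix with the same distribution as $P_UZP_V$, where $Z\in\mathbb{R}^{m_1\times m_2}$ has i.i.d. $\mathcal{N}(0,\sigma^2)$ entries. Define $$\mathcal{T}=\bigcup_{u_1,\dots,u_R\in\mathcal{U},\;v_1,\dots,v_R\in\mathcal{V}}\operatorname{span}\{u_kv_k^T:1\le k\le R\}\subseteq\mathbb{R}^{m_1\times m_2}.$$ (a) $\mathcal{T}$ is a linear space, of dimension $R^2$; $X\in\mathcal{T}$ almost surely; and $X$ has, with respect to the ($R^2$-dimensional) Lebesgue measure on $\mathcal{T}$ for the Frobenius inner product, the density $$f(M)=(2\pi\sigma^2)^{-R^2/2}\exp\Big\{\operatorname{tr}\Big(-\frac{1}{2\sigma^2}(MP_V)^T(P_UM)\Big)\Big\},\qquad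 M\in\mathcal{T}.$$ Equivalently, the vectorization $\operatorname{vec}(X)\in\mathbb{R}^{m_1m_2}$ (columns stacked) follows the degenerate Gaussian distribution $\mathcal{N}(0,\sigma^2(P_V\otimes P_U))$: the image under $\operatorname{vec}$ of the measure with density $f$ on $\mathcal{T}$ is this Gaussian distribution, whose covariance matrix is positive semidefinite. (b) Let $\Omega\subseteq[m_1]\times[m_2]$ be a set of $N$ indices, $\Omega^c$ its complement, and $\eta>0$. Let $Y_{i,j}=X_{i,j}+\epsilon_{i,j}$ for $(i,j)\in\Omega$, where the $\epsilon_{i,j}$ are i.i.d. $\mathcal{N}(0,\eta^2)$ and independent of $X$. Write $Y_\Omega$ for the vector of these observations and $X_{\Omega^c}$ for the vector of the entries of $X$ at $\Omega^c$. Order the indices so that those in $\Omega$ come first, and consider the block decomposition $$P_V\otimes P_U=\begin{pmatrix}(P_V\otimes P_U)_{\Omega}&(P_V\otimes P_U)_{\Omega,\Omega^c}\\(P_V\otimes P_U)_{\Omega,\Omega^c}^T&(P_V\otimes P_U)_{\Omega^c}\end{pmatrix}.$$ Let $\gamma^2=\eta^2/\sigma^2$ and $R_N(\Omega)=(P_V\otimes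 P_U)_\Omega\in\mathbb{R}^{N\times N}$. Then $R_N(\Omega)+\gamma^2I$ is invertible and, conditional on $Y_\Omega$, the unobserved entries are Gaussian, $[X_{\Omega^c}\mid Y_\Omega]\sim\mathcal{N}(X^P_{\Omega^c},\Sigma^P_{\Omega^c})$ almost surely, where $$X^P_{\Omega^c}=(P_V\otimes P_U)_{\Omega,\Omega^c}^T\,[R_N(\Omega)+\gamma^2I]^{-1}\,Y_\Omega,$$ $$\Sigma^P_{\Omega^c}=\sigma^2\Big\{(P_V\otimes P_U)_{\Omega^c}-(P_V\otimes P_U)_{\Omega,\Omega^c}^T\,[R_N(\Omega)+\gamma^2I]^{-1}\,(P_V\otimes P_U)_{\Omega,\Omega^c}\Big\},$$ and $\Sigma^P_{\Omega^c}$ is positive semidefinite. -/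

import Mathlib

open MeasureTheory ProbabilityTheory Matrix
open scoped Kronecker ENNReal MeasureTheory

noncomputable section

namespace MatrixCompletion

/-- The entrywise product of the Borel σ-algebras, which is the Borel σ-algebra on matrices. -/
instance instMeasurableSpaceMatrix (m n : Type*) : MeasurableSpace (Matrix m n ℝ) :=
  inferInstanceAs (MeasurableSpace (m → n → ℝ))

/-- The law of an `m₁ × m₂` random matrix with i.i.d. `N(0, σ²)` entries. -/
def gaussianEnsemble (m₁ m₂ : ℕ) (σ : ℝ) : Measure (Matrix (Fin m₁) (Fin m₂) ℝ) :=
  (Measure.pi fun _ : Fin m₁ ↦ Measure.pi fun _ : Fin m₂ ↦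
    gaussianReal 0 (σ ^ 2).toNNReal).map Matrix.of

/-- `Q = W Wᵀ` for some `m × R` matrix `W` with orthonormal columns: `Q` is the matrix of the
orthogonal projection of `ℝᵐ` onto an `R`-dimensional subspace. -/
def IsProjectionOfRank {m : ℕ} (R : ℕ) (Q : Matrix (Fin m) (Fin m) ℝ) : Prop :=
  ∃ W : Matrix (Fin m) (Fin R) ℝ, Wᵀ * W = 1 ∧ Q = W * Wᵀ

/-- `X ∼ SMG(P_U, P_V, σ², R)`: the random matrix `X` has the law of `P_U Z P_V`, where `Z` is a
matrix with i.i.d. `N(0, σ²)` entries. -/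
structure IsSMG {S : Type*} [MeasurableSpace S] {m₁ m₂ : ℕ}
    (X : S → Matrix (Fin m₁) (Fin m₂) ℝ)
    (PU : Matrix (Fin m₁) (Fin m₁) ℝ) (PV : Matrix (Fin m₂) (Fin m₂) ℝ)
    (σ : ℝ) (R : ℕ) (P : Measure S) : Prop where
  rank_lt : R < min m₁ m₂
  left_proj : IsProjectionOfRank R PU
  right_proj : IsProjectionOfRank R PV
  hasLaw : HasLaw X ((gaussianEnsemble m₁ m₂ σ).map fun Z ↦ PU * Z * PV) P

/-- The plane of a projection matrix, that is, its image. -/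
def plane {m : ℕ} (Q : Matrix (Fin m) (Fin m) ℝ) : Submodule ℝ (Fin m → ℝ) :=
  LinearMap.range Q.mulVecLin

/-- The union of the linear spans of `u₁ v₁ᵀ, …, u_R v_Rᵀ` over all `u₁, …, u_R` in the plane of
`P_U` and all `v₁, …, v_R` in the plane of `P_V`. -/
def spaceT {m₁ m₂ : ℕ} (PU : Matrix (Fin m₁) (Fin m₁) ℝ) (PV : Matrix (Fin m₂) (Fin m₂) ℝ)
    (R : ℕ) : Set (Matrix (Fin m₁) (Fin m₂) ℝ) :=
  ⋃ (u : Fin R → plane PU) (v : Fin R → plane PV),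
    (Submodule.span ℝ (Set.range fun k ↦ vecMulVec (u k : Fin m₁ → ℝ) (v k : Fin m₂ → ℝ)) :
      Set (Matrix (Fin m₁) (Fin m₂) ℝ))

/-- Vectorization by stacking columns, as a vector of a Euclidean space; the entry of index
`(j, i)` is `M i j`. -/
def vecE {m₁ m₂ : ℕ} (M : Matrix (Fin m₁) (Fin m₂) ℝ) : EuclideanSpace ℝ (Fin m₂ × Fin m₁) :=
  WithLp.toLp 2 M.vec

/-- The inverse of `vecE`. -/
def unvecE {m₁ m₂ : ℕ} (x : EuclideanSpace ℝ (Fin m₂ × Fin m₁)) : Matrix (Fin m₁) (Fin m₂) ℝ :=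
  Matrix.of fun i j ↦ x (j, i)

/-- The `d`-dimensional surface measure on a set `T` of matrices, for the Frobenius metric. If `T`
is a linear subspace of dimension `d`, this is the Lebesgue measure of `T`. -/
def lebesgueOn {m₁ m₂ : ℕ} (d : ℕ) (T : Set (Matrix (Fin m₁) (Fin m₂) ℝ)) :
    Measure (Matrix (Fin m₁) (Fin m₂) ℝ) :=
  ((Measure.euclideanHausdorffMeasure d).restrict (vecE '' T)).map unvecE

/-- The exponential of the trace. -/
def etr {n : ℕ} (A : Matrix (Fin n) (Fin n) ℝ) : ℝ := Real.exp A.trace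

/-- The density `f`. -/
def smgDensity {m₁ m₂ : ℕ} (PU : Matrix (Fin m₁) (Fin m₁) ℝ) (PV : Matrix (Fin m₂) (Fin m₂) ℝ)
    (σ : ℝ) (R : ℕ) (M : Matrix (Fin m₁) (Fin m₂) ℝ) : ℝ :=
  (2 * Real.pi * σ ^ 2) ^ (-((R : ℝ) ^ 2) / 2) *
    etr ((-(1 / (2 * σ ^ 2))) • ((M * PV)ᵀ * (PU * M)))

/-- The measure on matrices with density `f` with respect to the Lebesgue measure of `T`. -/
def smgDensityLaw {m₁ m₂ : ℕ} (PU : Matrix (Fin m₁) (Fin m₁) ℝ)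
    (PV : Matrix (Fin m₂) (Fin m₂) ℝ) (σ : ℝ) (R : ℕ) :
    Measure (Matrix (Fin m₁) (Fin m₂) ℝ) :=
  (lebesgueOn (R ^ 2) (spaceT PU PV R)).withDensity
    fun M ↦ ENNReal.ofReal (smgDensity PU PV σ R M)

/-- The entries of `M` at the indices outside `Ω`. -/
def unobserved {m₁ m₂ : ℕ} (Ω : Finset (Fin m₁ × Fin m₂)) (M : Matrix (Fin m₁) (Fin m₂) ℝ) :
    EuclideanSpace ℝ {p // p ∉ Ω} :=
  WithLp.toLp 2 fun p ↦ M p.1.1 p.1.2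

/-- `Y` consists of the entries of `X` at the indices in `Ω`, each with an additive `N(0, η²)`
noise; the noise variables are independent, and the noise is independent of `X`. -/
def IsNoisyObservation {S : Type*} [MeasurableSpace S] {m₁ m₂ : ℕ}
    (X : S → Matrix (Fin m₁) (Fin m₂) ℝ) (Ω : Finset (Fin m₁ × Fin m₂)) (η : ℝ)
    (Y : S → EuclideanSpace ℝ {p // p ∈ Ω}) (P : Measure S) : Prop :=
  ∃ ε : {p // p ∈ Ω} → S → ℝ,
    (∀ p, HasLaw (ε p) (gaussianReal 0 (η ^ 2).toNNReal) P) ∧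
    iIndepFun ε P ∧
    IndepFun X (fun s p ↦ ε p s) P ∧
    ∀ s p, Y s p = X s p.1.1 p.1.2 + ε p s

section Blocks

variable {m₁ m₂ : ℕ} (PU : Matrix (Fin m₁) (Fin m₁) ℝ) (PV : Matrix (Fin m₂) (Fin m₂) ℝ)
  (Ω : Finset (Fin m₁ × Fin m₂))

/-- The block `(P_V ⊗ P_U)_Ω`, also called `R_N(Ω)`. The index `(j, i)` of the Kronecker product is
the place of the entry `(i, j)` in the vectorization, whence the swap. -/
def kronObs : Matrix {p // p ∈ Ω} {p // p ∈ Ω} ℝ :=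
  (PV ⊗ₖ PU).submatrix (fun p ↦ p.1.swap) (fun p ↦ p.1.swap)

/-- The block `(P_V ⊗ P_U)_{Ω, Ωᶜ}`. -/
def kronCross : Matrix {p // p ∈ Ω} {p // p ∉ Ω} ℝ :=
  (PV ⊗ₖ PU).submatrix (fun p ↦ p.1.swap) (fun p ↦ p.1.swap)

/-- The block `(P_V ⊗ P_U)_{Ωᶜ}`. -/
def kronUnobs : Matrix {p // p ∉ Ω} {p // p ∉ Ω} ℝ :=
  (PV ⊗ₖ PU).submatrix (fun p ↦ p.1.swap) (fun p ↦ p.1.swap)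

/-- The matrix `[R_N(Ω) + γ² I]⁻¹`, with `γ² = η² / σ²`. -/
def gainInv (σ η : ℝ) : Matrix {p // p ∈ Ω} {p // p ∈ Ω} ℝ :=
  (kronObs PU PV Ω + (η ^ 2 / σ ^ 2) • (1 : Matrix {p // p ∈ Ω} {p // p ∈ Ω} ℝ))⁻¹

/-- The conditional mean, as a function of the observed vector `y`. -/
def condMean (σ η : ℝ) (y : EuclideanSpace ℝ {p // p ∈ Ω}) : EuclideanSpace ℝ {p // p ∉ Ω} :=
  WithLp.toLp 2 (((kronCross PU PV Ω)ᵀ * gainInv PU PV Ω σ η) *ᵥ y.ofLp)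

/-- The conditional covariance matrix. -/
def condCov (σ η : ℝ) : Matrix {p // p ∉ Ω} {p // p ∉ Ω} ℝ :=
  σ ^ 2 • (kronUnobs PU PV Ω - (kronCross PU PV Ω)ᵀ * gainInv PU PV Ω σ η * kronCross PU PV Ω)

end Blocks

end MatrixCompletion

end

namespace MatrixCompletion

/-! Write `P_U = U Uᵀ`, `P_V = V Vᵀ`. The space `T` is the range of the injective map `A ↦ U A Vᵀ`
(`range_sandwich`), which in vectorized form is the isometry `V ⊗ U`. It carries Lebesgue measure on
`ℝ^(R×R)` to that of `T`, and the density `f` to the isotropic Gaussian density. Hence the law with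
density `f` is the Gaussian with covariance `σ² (V ⊗ U)(V ⊗ U)ᵀ = σ² (P_V ⊗ P_U)`
(`smgDensityLaw_eq_map`). The vectorization of `P_U Z P_V` has the same law, because `P_V ⊗ P_U` is
a symmetric idempotent (`IsSMG.hasLaw_vecE`).

For the conditional law, apply to the Gaussian vector `(vec X, ε)` the linear map giving `Y` and the
residual `X_Ωᶜ - A Y`, with `A` the regression matrix. The covariance becomes block diagonal
(`fromBlocks_conj_eq_fromBlocks`), so the residual is independent of `Y`, and conditioning on `Y`
merely translates its law by `A Y` (`condDistrib_add_of_hasLaw_prod`). No invertibility of the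
covariance of `X` is needed. -/

theorem posSemidef_fromBlocks_zero {ι κ : Type*} [Fintype ι] [Fintype κ]
    {S : Matrix ι ι ℝ} {T : Matrix κ κ ℝ} (hS : S.PosSemidef) (hT : T.PosSemidef) :
    (fromBlocks S 0 0 T).PosSemidef := by
  refine PosSemidef.of_dotProduct_mulVec_nonneg ?_ fun x ↦ ?_
  · exact isHermitian_fromBlocks_iff.2 ⟨hS.1, by simp, by simp, hT.1⟩
  · rw [← Sum.elim_comp_inl_inr x, fromBlocks_mulVec]
    have h1 := hS.dotProduct_mulVec_nonneg (x ∘ Sum.inl)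
    have h2 := hT.dotProduct_mulVec_nonneg (x ∘ Sum.inr)
    simp only [star_trivial, zero_mulVec, add_zero, zero_add, sumElim_dotProduct_sumElim] at *
    exact add_nonneg h1 h2

theorem measurable_toLp_sumElim {ι κ : Type*} [Fintype ι] [Fintype κ] :
    Measurable fun p : EuclideanSpace ℝ ι × EuclideanSpace ℝ κ ↦
      (WithLp.toLp 2 (Sum.elim p.1.ofLp p.2.ofLp) : EuclideanSpace ℝ (ι ⊕ κ)) := by
  refine (WithLp.measurable_toLp _ _).comp (measurable_pi_iff.2 fun i ↦ ?_)
  cases i <;> simp <;> fun_prop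

/-! ### Gaussian measures, identified through characteristic functions -/

section Gaussian

variable {ι κ : Type*} [Fintype ι] [DecidableEq ι] [Fintype κ] [DecidableEq κ]

/-- The image of a Gaussian measure under a linear map. -/
theorem map_mulVec_multivariateGaussian {S : Matrix ι ι ℝ} (hS : S.PosSemidef)
    (A : Matrix κ ι ℝ) :
    (multivariateGaussian 0 S).map (fun x ↦ WithLp.toLp 2 (A *ᵥ x.ofLp)) =
      multivariateGaussian 0 (A * S * Aᵀ) := by
  have hA : (A * S * Aᵀ).PosSemidef := by
    simpa using hS.mul_mul_conjTranspose_same A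
  apply Measure.ext_of_charFun
  ext t
  have hm : Measurable fun x : EuclideanSpace ℝ ι ↦
      (WithLp.toLp 2 (A *ᵥ x.ofLp) : EuclideanSpace ℝ κ) := by
    fun_prop
  have key : charFun ((multivariateGaussian 0 S).map fun x ↦ WithLp.toLp 2 (A *ᵥ x.ofLp)) t =
      charFun (multivariateGaussian 0 S) (WithLp.toLp 2 (Aᵀ *ᵥ t.ofLp)) := by
    rw [charFun_apply, charFun_apply, integral_map hm.aemeasurable (by fun_prop)]
    congr with x
    simp only [EuclideanSpace.inner_eq_star_dotProduct, star_trivial]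
    rw [dotProduct_mulVec, mulVec_transpose]
  rw [key, charFun_multivariateGaussian hS, charFun_multivariateGaussian hA]
  simp only [inner_zero_right, mulVec_transpose, ← mulVec_mulVec, ← dotProduct_mulVec]

theorem map_add_multivariateGaussian (μ : EuclideanSpace ℝ ι) (S : Matrix ι ι ℝ) :
    (multivariateGaussian 0 S).map (fun x ↦ μ + x) = multivariateGaussian μ S := by
  rw [multivariateGaussian, multivariateGaussian, Measure.map_map (by fun_prop) (by fun_prop)]
  simp [Function.comp_def]

/-- The product of two Gaussian measures, as a Gaussian measure on the product space. -/
theorem map_sumElim_prod_multivariateGaussian {S : Matrix ι ι ℝ} {T : Matrix κ κ ℝ}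
    (hS : S.PosSemidef) (hT : T.PosSemidef) :
    ((multivariateGaussian 0 S).prod (multivariateGaussian 0 T)).map
        (fun p ↦ WithLp.toLp 2 (Sum.elim p.1.ofLp p.2.ofLp)) =
      multivariateGaussian 0 (fromBlocks S 0 0 T) := by
  have hST := posSemidef_fromBlocks_zero hS hT
  have hm := measurable_toLp_sumElim (ι := ι) (κ := κ)
  have : IsProbabilityMeasure (((multivariateGaussian 0 S).prod (multivariateGaussian 0 T)).map
        (fun p ↦ (WithLp.toLp 2 (Sum.elim p.1.ofLp p.2.ofLp) : EuclideanSpace ℝ (ι ⊕ κ)))) :=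
    Measure.isProbabilityMeasure_map hm.aemeasurable
  apply Measure.ext_of_charFun
  ext t
  have key : charFun (((multivariateGaussian 0 S).prod (multivariateGaussian 0 T)).map
        (fun p ↦ WithLp.toLp 2 (Sum.elim p.1.ofLp p.2.ofLp))) t =
      charFun (multivariateGaussian 0 S) (WithLp.toLp 2 (t.ofLp ∘ Sum.inl)) *
        charFun (multivariateGaussian 0 T) (WithLp.toLp 2 (t.ofLp ∘ Sum.inr)) := by
    rw [charFun_apply, charFun_apply, charFun_apply, integral_map hm.aemeasurable (by fun_prop),
      ← integral_prod_mul]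
    congr with x
    rw [← Complex.exp_add, ← add_mul, ← Complex.ofReal_add]
    congr 3
    simp [PiLp.inner_apply]
  rw [key, charFun_multivariateGaussian hS, charFun_multivariateGaussian hT,
    charFun_multivariateGaussian hST, ← Complex.exp_add]
  congr 1
  have : t.ofLp ⬝ᵥ fromBlocks S 0 0 T *ᵥ t.ofLp =
      (t.ofLp ∘ Sum.inl) ⬝ᵥ S *ᵥ (t.ofLp ∘ Sum.inl) +
        (t.ofLp ∘ Sum.inr) ⬝ᵥ T *ᵥ (t.ofLp ∘ Sum.inr) := by
    conv_lhs => rw [← Sum.elim_comp_inl_inr t.ofLp, fromBlocks_mulVec]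
    simp [dotProduct]
  simp only [this]
  simp
  ring

/-- A vector with i.i.d. centred normal entries is Gaussian. -/
theorem map_toLp_pi_gaussianReal (σ : ℝ) :
    (Measure.pi fun _ : ι ↦ gaussianReal 0 (σ ^ 2).toNNReal).map (WithLp.toLp 2) =
      multivariateGaussian 0 (σ ^ 2 • (1 : Matrix ι ι ℝ)) := by
  have hS : (σ ^ 2 • (1 : Matrix ι ι ℝ)).PosSemidef := PosSemidef.one.smul (sq_nonneg σ)
  have : IsProbabilityMeasure ((Measure.pi fun _ : ι ↦ gaussianReal 0 (σ ^ 2).toNNReal).map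
      (WithLp.toLp 2)) := Measure.isProbabilityMeasure_map (by fun_prop)
  apply Measure.ext_of_charFun
  ext t
  simp_rw [charFun_multivariateGaussian hS, charFun_pi, charFun_gaussianReal, ← Complex.exp_sum]
  congr 1
  simp [smul_mulVec, dotProduct, Finset.sum_div, Real.coe_toNNReal _ (sq_nonneg σ)]
  exact Finset.sum_congr rfl fun i _ ↦ by ring

/-- The density of a vector with i.i.d. centred normal entries. -/
theorem withDensity_eq_multivariateGaussian {σ : ℝ} (hσ : 0 < σ) :
    (volume : Measure (EuclideanSpace ℝ ι)).withDensity (fun x ↦ ENNReal.ofReal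
        ((2 * Real.pi * σ ^ 2) ^ (-(Fintype.card ι : ℝ) / 2) *
          Real.exp (-(1 / (2 * σ ^ 2)) * ‖x‖ ^ 2))) =
      multivariateGaussian 0 (σ ^ 2 • (1 : Matrix ι ι ℝ)) := by
  have hS : (σ ^ 2 • (1 : Matrix ι ι ℝ)).PosSemidef := PosSemidef.one.smul (sq_nonneg σ)
  set b : ℝ := 1 / (2 * σ ^ 2) with hb
  have hb0 : 0 < b := by positivity
  set c : ℝ := (2 * Real.pi * σ ^ 2) ^ (-(Fintype.card ι : ℝ) / 2) with hc
  have hc0 : 0 < c := by positivity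
  -- Finiteness is enough to compare characteristic functions; that the total mass is one then
  -- follows from their equality.
  have hint : Integrable (fun x : EuclideanSpace ℝ ι ↦ c * Real.exp (-b * ‖x‖ ^ 2)) := by
    have := (GaussianFourier.integrable_cexp_neg_mul_sq_norm_add (V := EuclideanSpace ℝ ι)
      (b := b) (by simpa using hb0) 0 0).re
    refine Integrable.const_mul (this.congr (Filter.Eventually.of_forall fun x ↦ ?_)) c
    simp only [zero_mul, add_zero]
    rw [← Complex.ofReal_pow, ← Complex.ofReal_neg, ← Complex.ofReal_mul, ← Complex.ofReal_exp]
    rfl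
  have : IsFiniteMeasure ((volume : Measure (EuclideanSpace ℝ ι)).withDensity
      (fun x ↦ ENNReal.ofReal (c * Real.exp (-b * ‖x‖ ^ 2)))) :=
    isFiniteMeasure_withDensity_ofReal hint.2
  apply Measure.ext_of_charFun
  ext t
  rw [charFun_multivariateGaussian hS, charFun_apply,
    integral_withDensity_eq_integral_toReal_smul (by fun_prop) (by simp)]
  have h1 : ∀ x : EuclideanSpace ℝ ι,
      (ENNReal.ofReal (c * Real.exp (-b * ‖x‖ ^ 2))).toReal •
        Complex.exp ((inner ℝ x t : ℝ) * Complex.I) =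
      (c : ℂ) * Complex.exp (-(b : ℂ) * ‖x‖ ^ 2 + Complex.I * (inner ℝ t x : ℝ)) := by
    intro x
    rw [ENNReal.toReal_ofReal (by positivity), Complex.real_smul, Complex.exp_add]
    push_cast
    rw [real_inner_comm]
    ring_nf
  simp_rw [h1]
  rw [integral_const_mul, GaussianFourier.integral_cexp_neg_mul_sq_norm_add (by simpa using hb0),
    ← mul_assoc]
  -- The Gaussian integral contributes `(π / b)^(n/2) = (2πσ²)^(n/2)`, the inverse of the
  -- normalizing constant `c`.
  have h2 : (c : ℂ) * (Real.pi / b : ℂ) ^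
      (Module.finrank ℝ (EuclideanSpace ℝ ι) / 2 : ℂ) = 1 := by
    have : (Real.pi / b : ℂ) ^ (Module.finrank ℝ (EuclideanSpace ℝ ι) / 2 : ℂ) =
        ((2 * Real.pi * σ ^ 2 : ℝ) ^ ((Fintype.card ι : ℝ) / 2) : ℝ) := by
      rw [Complex.ofReal_cpow (by positivity), hb]
      push_cast
      simp only [finrank_euclideanSpace]
      congr 1
      field_simp
    rw [this, ← Complex.ofReal_mul, hc, ← Real.rpow_add (by positivity)]
    simp [neg_div]
  rw [h2, one_mul]
  congr 1
  have h3 : t.ofLp ⬝ᵥ (σ ^ 2 • (1 : Matrix ι ι ℝ)) *ᵥ t.ofLp = σ ^ 2 * ‖t‖ ^ 2 := by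
    rw [smul_mulVec, one_mulVec, dotProduct_smul, EuclideanSpace.real_norm_sq_eq]
    simp [dotProduct, sq]
  have hσ' : (σ : ℂ) ≠ 0 := by exact_mod_cast hσ.ne'
  rw [h3, hb]
  push_cast
  simp only [inner_zero_right, Complex.ofReal_zero, zero_mul, zero_sub, Complex.I_sq]
  field_simp
  ring

end Gaussian

/-- Change of variables for densities; it lets the density on `T` be evaluated in the coordinates
`ℝ^(R×R)`. -/
theorem withDensity_map {α β : Type*} [MeasurableSpace α] [MeasurableSpace β] {μ : Measure α}
    {f : α → β} (hf : Measurable f) {g : β → ℝ≥0∞} (hg : Measurable g) :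
    (μ.map f).withDensity g = (μ.withDensity (g ∘ f)).map f := by
  ext s hs
  rw [withDensity_apply _ hs, Measure.map_apply hf hs, withDensity_apply _ (hf hs),
    Measure.restrict_map hf hs, lintegral_map hg hf]
  rfl

/-! ### Vectorization of matrices and of the Gaussian ensemble -/

section Vectorization

variable {m₁ m₂ : ℕ}

theorem measurable_vecE : Measurable (vecE : Matrix (Fin m₁) (Fin m₂) ℝ → _) := by
  refine (WithLp.measurable_toLp _ _).comp (measurable_pi_iff.2 fun p ↦ ?_)
  exact (measurable_pi_apply p.1).comp (measurable_pi_apply p.2)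

theorem measurable_unvecE :
    Measurable (unvecE : _ → Matrix (Fin m₁) (Fin m₂) ℝ) := by
  refine measurable_pi_iff.2 fun i ↦ measurable_pi_iff.2 fun j ↦ ?_
  change Measurable fun x : EuclideanSpace ℝ (Fin m₂ × Fin m₁) ↦ x (j, i)
  fun_prop

theorem measurable_mul_mul {n₁ n₂ : ℕ} (A : Matrix (Fin n₁) (Fin m₁) ℝ)
    (B : Matrix (Fin m₂) (Fin n₂) ℝ) :
    Measurable fun Z : Matrix (Fin m₁) (Fin m₂) ℝ ↦ A * Z * B := by
  refine measurable_pi_iff.2 fun i ↦ measurable_pi_iff.2 fun j ↦ ?_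
  simp only [Matrix.mul_apply]
  refine Finset.measurable_sum _ fun k _ ↦ Measurable.mul_const ?_ _
  refine Finset.measurable_sum _ fun l _ ↦ Measurable.const_mul ?_ _
  exact (measurable_pi_apply k).comp (measurable_pi_apply l)

@[simp]
theorem unvecE_vecE (M : Matrix (Fin m₁) (Fin m₂) ℝ) : unvecE (vecE M) = M := rfl

theorem norm_vecE_sq (M : Matrix (Fin m₁) (Fin m₂) ℝ) : ‖vecE M‖ ^ 2 = (Mᵀ * M).trace := by
  rw [EuclideanSpace.real_norm_sq_eq, ← vec_dotProduct_vec]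
  simp [vecE, dotProduct, sq]

theorem vecE_mul_mul {n₁ n₂ : ℕ} (A : Matrix (Fin n₁) (Fin m₁) ℝ)
    (M : Matrix (Fin m₁) (Fin m₂) ℝ) (B : Matrix (Fin n₂) (Fin m₂) ℝ) :
    vecE (A * M * Bᵀ) = WithLp.toLp 2 ((B ⊗ₖ A) *ᵥ (vecE M).ofLp) := by
  simp only [vecE, kronecker_mulVec_vec]

theorem map_vecE_gaussianEnsemble (σ : ℝ) :
    (gaussianEnsemble m₁ m₂ σ).map vecE = multivariateGaussian 0 (σ ^ 2 • 1) := by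
  have hS : (σ ^ 2 • (1 : Matrix (Fin m₂ × Fin m₁) (Fin m₂ × Fin m₁) ℝ)).PosSemidef :=
    PosSemidef.one.smul (sq_nonneg σ)
  have hof : Measurable (Matrix.of : (Fin m₁ → Fin m₂ → ℝ) → Matrix (Fin m₁) (Fin m₂) ℝ) :=
    measurable_id
  have hm := measurable_vecE.comp hof
  rw [gaussianEnsemble, Measure.map_map measurable_vecE hof]
  have : IsProbabilityMeasure ((Measure.pi fun _ : Fin m₁ ↦ Measure.pi fun _ : Fin m₂ ↦
      gaussianReal 0 (σ ^ 2).toNNReal).map (vecE ∘ Matrix.of)) :=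
    Measure.isProbabilityMeasure_map hm.aemeasurable
  apply Measure.ext_of_charFun
  ext t
  rw [charFun_multivariateGaussian hS, charFun_apply,
    integral_map hm.aemeasurable (by fun_prop)]
  -- The character splits into one factor per entry, so the integral over the nested product measure
  -- is a double product of one-dimensional characteristic functions.
  have h : ∀ z : Fin m₁ → Fin m₂ → ℝ,
      Complex.exp ((inner ℝ ((vecE ∘ Matrix.of) z) t : ℝ) * Complex.I) =
        ∏ i, ∏ j, Complex.exp (t (j, i) * z i j * Complex.I) := by
    intro z
    simp_rw [← Complex.exp_sum, PiLp.inner_apply, Fintype.sum_prod_type]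
    rw [Finset.sum_comm]
    simp [vecE, Finset.sum_mul, flip]
  simp_rw [h]
  rw [integral_fintype_prod_eq_prod
    (f := fun i (x : Fin m₂ → ℝ) ↦ ∏ j, Complex.exp (t (j, i) * x j * Complex.I))]
  have h' : ∀ i, ∫ x : Fin m₂ → ℝ, ∏ j, Complex.exp (t (j, i) * x j * Complex.I)
        ∂(Measure.pi fun _ ↦ gaussianReal 0 (σ ^ 2).toNNReal) =
      ∏ j, Complex.exp (-(σ ^ 2 * t (j, i) ^ 2 / 2)) := by
    intro i
    rw [integral_fintype_prod_eq_prod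
      (f := fun j (x : ℝ) ↦ Complex.exp (t (j, i) * x * Complex.I))]
    refine Finset.prod_congr rfl fun j _ ↦ ?_
    rw [← charFun_apply_real, charFun_gaussianReal]
    simp [Real.coe_toNNReal _ (sq_nonneg σ)]
  simp_rw [h', ← Complex.exp_sum]
  congr 1
  rw [Finset.sum_comm, ← Fintype.sum_prod_type (f := fun x : Fin m₂ × Fin m₁ ↦
    (-((σ : ℂ) ^ 2 * (t x : ℂ) ^ 2 / 2)))]
  simp [smul_mulVec, dotProduct, Finset.sum_div]
  exact Finset.sum_congr rfl fun i _ ↦ by ring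

end Vectorization

/-! ### Matrices with orthonormal columns -/

section Projection

variable {m R : ℕ} {W : Matrix (Fin m) (Fin R) ℝ}

theorem mem_plane_mul_transpose (hW : Wᵀ * W = 1) {x : Fin m → ℝ} :
    x ∈ plane (W * Wᵀ) ↔ ∃ a, W *ᵥ a = x := by
  constructor
  · rintro ⟨y, rfl⟩
    exact ⟨Wᵀ *ᵥ y, by rw [mulVec_mulVec, mulVecLin_apply]⟩
  · rintro ⟨a, rfl⟩
    exact ⟨W *ᵥ a, by rw [mulVecLin_apply, mulVec_mulVec, Matrix.mul_assoc, hW, Matrix.mul_one]⟩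

theorem isometry_mulVec {ι κ : Type*} [Fintype ι] [DecidableEq ι] [Fintype κ] {W : Matrix κ ι ℝ}
    (hW : Wᵀ * W = 1) :
    Isometry fun x : EuclideanSpace ℝ ι ↦ (WithLp.toLp 2 (W *ᵥ x.ofLp) : EuclideanSpace ℝ κ) := by
  let L : EuclideanSpace ℝ ι →ₗ[ℝ] EuclideanSpace ℝ κ :=
    (WithLp.linearEquiv 2 ℝ (κ → ℝ)).symm ∘ₗ W.mulVecLin ∘ₗ (WithLp.linearEquiv 2 ℝ (ι → ℝ))
  refine AddMonoidHomClass.isometry_of_norm L fun x ↦ ?_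
  rw [← sq_eq_sq₀ (norm_nonneg _) (norm_nonneg _), ← real_inner_self_eq_norm_sq,
    ← real_inner_self_eq_norm_sq]
  simp only [EuclideanSpace.inner_eq_star_dotProduct, star_trivial]
  change W *ᵥ x.ofLp ⬝ᵥ W *ᵥ x.ofLp = _
  rw [dotProduct_mulVec, ← mulVec_transpose, mulVec_mulVec, hW, one_mulVec]

end Projection

/-! ### The space `T`, the density on it, and the law of `vec X` -/

section Space

variable {m₁ m₂ R : ℕ}

/-- The linear map `A ↦ U A Vᵀ`. -/
def sandwich (U : Matrix (Fin m₁) (Fin R) ℝ) (V : Matrix (Fin m₂) (Fin R) ℝ) :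
    Matrix (Fin R) (Fin R) ℝ →ₗ[ℝ] Matrix (Fin m₁) (Fin m₂) ℝ where
  toFun A := U * A * Vᵀ
  map_add' A B := by rw [Matrix.mul_add, Matrix.add_mul]
  map_smul' c A := by simp

variable {U : Matrix (Fin m₁) (Fin R) ℝ} {V : Matrix (Fin m₂) (Fin R) ℝ}

theorem sandwich_injective (hU : Uᵀ * U = 1) (hV : Vᵀ * V = 1) :
    Function.Injective (sandwich U V) := by
  refine Function.LeftInverse.injective (g := fun M ↦ Uᵀ * M * V) fun A ↦ ?_
  change Uᵀ * (U * A * Vᵀ) * V = A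
  rw [Matrix.mul_assoc, Matrix.mul_assoc, hV, Matrix.mul_one, ← Matrix.mul_assoc, hU,
    Matrix.one_mul]

theorem finrank_range_sandwich (hU : Uᵀ * U = 1) (hV : Vᵀ * V = 1) :
    Module.finrank ℝ (LinearMap.range (sandwich U V)) = R ^ 2 := by
  rw [LinearMap.finrank_range_of_inj (sandwich_injective hU hV), Module.finrank_matrix]
  simp [sq]

/-- A union of spans is linear here because `R` dyads always suffice: `U A Vᵀ` is the sum over `k`
of (column `k` of `U`) times (`V` applied to row `k` of `A`)ᵀ. Conversely, each dyad `(U a)(V b)ᵀ`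
is `U (a bᵀ) Vᵀ`. -/
theorem range_sandwich (hU : Uᵀ * U = 1) (hV : Vᵀ * V = 1) :
    (LinearMap.range (sandwich U V) : Set (Matrix (Fin m₁) (Fin m₂) ℝ)) =
      spaceT (U * Uᵀ) (V * Vᵀ) R := by
  ext M
  simp only [spaceT, Set.mem_iUnion, SetLike.mem_coe]
  constructor
  · rintro ⟨A, rfl⟩
    refine ⟨fun k ↦ ⟨U *ᵥ Pi.single k 1, (mem_plane_mul_transpose hU).2 ⟨_, rfl⟩⟩,
      fun k ↦ ⟨V *ᵥ A k, (mem_plane_mul_transpose hV).2 ⟨_, rfl⟩⟩, ?_⟩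
    have : sandwich U V A = ∑ k, vecMulVec (U *ᵥ Pi.single k 1) (V *ᵥ A k) := by
      ext i j
      change (U * A * Vᵀ) i j = _
      rw [Matrix.mul_assoc, Matrix.mul_apply, Matrix.sum_apply]
      refine Finset.sum_congr rfl fun k _ ↦ ?_
      simp [vecMulVec_apply, Matrix.mul_apply, mulVec, dotProduct, mul_comm]
    rw [this]
    exact Submodule.sum_mem _ fun k _ ↦ Submodule.subset_span ⟨k, rfl⟩
  · rintro ⟨u, v, h⟩
    refine Submodule.span_le.2 ?_ h
    rintro _ ⟨k, rfl⟩
    obtain ⟨a, ha⟩ := (mem_plane_mul_transpose hU).1 (u k).2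
    obtain ⟨b, hb⟩ := (mem_plane_mul_transpose hV).1 (v k).2
    refine ⟨vecMulVec a b, ?_⟩
    change U * vecMulVec a b * Vᵀ = _
    rw [mul_vecMulVec, vecMulVec_mul, ha, vecMul_transpose, hb]

theorem transpose_kronecker_mul_kronecker (hU : Uᵀ * U = 1) (hV : Vᵀ * V = 1) :
    (V ⊗ₖ U)ᵀ * (V ⊗ₖ U) = 1 := by
  rw [← kroneckerMap_transpose, ← mul_kronecker_mul, hU, hV, one_kronecker_one]

theorem kronecker_mul_transpose_kronecker :
    (V ⊗ₖ U) * (V ⊗ₖ U)ᵀ = (V * Vᵀ) ⊗ₖ (U * Uᵀ) := by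
  rw [← kroneckerMap_transpose, ← mul_kronecker_mul]

theorem vecE_sandwich (x : EuclideanSpace ℝ (Fin R × Fin R)) :
    vecE (sandwich U V (unvecE x)) = WithLp.toLp 2 ((V ⊗ₖ U) *ᵥ x.ofLp) :=
  vecE_mul_mul U (unvecE x) V

theorem image_vecE_spaceT (hU : Uᵀ * U = 1) (hV : Vᵀ * V = 1) :
    vecE '' spaceT (U * Uᵀ) (V * Vᵀ) R =
      Set.range fun x : EuclideanSpace ℝ (Fin R × Fin R) ↦
        (WithLp.toLp 2 ((V ⊗ₖ U) *ᵥ x.ofLp) : EuclideanSpace ℝ (Fin m₂ × Fin m₁)) := by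
  rw [← range_sandwich hU hV]
  ext y
  constructor
  · rintro ⟨_, ⟨A, rfl⟩, rfl⟩
    exact ⟨vecE A, (vecE_sandwich (vecE A)).symm⟩
  · rintro ⟨x, rfl⟩
    exact ⟨_, ⟨unvecE x, rfl⟩, vecE_sandwich x⟩

theorem measurable_smgDensity (PU : Matrix (Fin m₁) (Fin m₁) ℝ) (PV : Matrix (Fin m₂) (Fin m₂) ℝ)
    (σ : ℝ) (R : ℕ) : Measurable (smgDensity PU PV σ R) := by
  have hl : Measurable fun M : Matrix (Fin m₁) (Fin m₂) ℝ ↦ PU * M := by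
    simpa using measurable_mul_mul PU (1 : Matrix (Fin m₂) (Fin m₂) ℝ)
  have hr : Measurable fun M : Matrix (Fin m₁) (Fin m₂) ℝ ↦ M * PV := by
    simpa using measurable_mul_mul (1 : Matrix (Fin m₁) (Fin m₁) ℝ) PV
  have he {n₁ n₂ : ℕ} {f : Matrix (Fin m₁) (Fin m₂) ℝ → Matrix (Fin n₁) (Fin n₂) ℝ}
      (hf : Measurable f) (i : Fin n₁) (j : Fin n₂) : Measurable fun M ↦ f M i j :=
    (measurable_pi_iff.1 (measurable_pi_iff.1 hf i) j)
  unfold smgDensity etr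
  refine (Real.measurable_exp.comp ?_).const_mul _
  simp only [trace_smul, smul_eq_mul]
  refine Measurable.const_mul (Finset.measurable_sum _ fun i _ ↦ ?_) _
  simp only [diag_apply, Matrix.mul_apply, transpose_apply]
  -- Only the outer product should stay expanded; the inner sums are folded back into entries of `M
  -- * PV` and `PU * M`.
  simp only [← Matrix.mul_apply]
  refine Finset.measurable_sum _ fun j _ ↦ ?_
  exact (he hr j i).mul (he hl j i)

/-- Both projections fix `U A Vᵀ`, so the trace in the exponent is its squared Frobenius norm, which
the isometry `V ⊗ U` equates with `‖x‖²`. -/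
theorem smgDensity_sandwich (hU : Uᵀ * U = 1) (hV : Vᵀ * V = 1) (σ : ℝ)
    (x : EuclideanSpace ℝ (Fin R × Fin R)) :
    smgDensity (U * Uᵀ) (V * Vᵀ) σ R (sandwich U V (unvecE x)) =
      (2 * Real.pi * σ ^ 2) ^ (-(Fintype.card (Fin R × Fin R) : ℝ) / 2) *
          Real.exp (-(1 / (2 * σ ^ 2)) * ‖x‖ ^ 2) := by
  have hn : ‖x‖ = ‖vecE (sandwich U V (unvecE x))‖ := by
    rw [vecE_sandwich]
    have h := (isometry_mulVec (transpose_kronecker_mul_kronecker hU hV)).dist_eq x 0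
    simpa using h.symm
  have h1 : sandwich U V (unvecE x) * (V * Vᵀ) = sandwich U V (unvecE x) := by
    change U * unvecE x * Vᵀ * (V * Vᵀ) = U * unvecE x * Vᵀ
    rw [Matrix.mul_assoc, ← Matrix.mul_assoc Vᵀ, hV, Matrix.one_mul]
  have h2 : U * Uᵀ * sandwich U V (unvecE x) = sandwich U V (unvecE x) := by
    change U * Uᵀ * (U * unvecE x * Vᵀ) = U * unvecE x * Vᵀ
    rw [Matrix.mul_assoc U, Matrix.mul_assoc U, ← Matrix.mul_assoc Uᵀ, hU, Matrix.one_mul]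
  rw [smgDensity, etr, h1, h2, hn, norm_vecE_sq, trace_smul, smul_eq_mul]
  simp [sq]

theorem smgDensityLaw_eq_map (hU : Uᵀ * U = 1) (hV : Vᵀ * V = 1) {σ : ℝ} (hσ : 0 < σ) :
    smgDensityLaw (U * Uᵀ) (V * Vᵀ) σ R =
      (multivariateGaussian 0 (σ ^ 2 • ((V * Vᵀ) ⊗ₖ (U * Uᵀ)))).map unvecE := by
  have hS : (σ ^ 2 • (1 : Matrix (Fin R × Fin R) (Fin R × Fin R) ℝ)).PosSemidef :=
    PosSemidef.one.smul (sq_nonneg σ)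
  have hL := isometry_mulVec (transpose_kronecker_mul_kronecker hU hV)
  have hLm : Measurable fun x : EuclideanSpace ℝ (Fin R × Fin R) ↦
      (WithLp.toLp 2 ((V ⊗ₖ U) *ᵥ x.ofLp) : EuclideanSpace ℝ (Fin m₂ × Fin m₁)) :=
    hL.continuous.measurable
  -- The coordinate space has dimension `R * R`, the dimension of the surface measure, which is
  -- therefore Lebesgue measure there.
  have hvol : (Measure.euclideanHausdorffMeasure (R ^ 2) :
      Measure (EuclideanSpace ℝ (Fin R × Fin R))) = volume := by
    rw [← InnerProductSpace.euclideanHausdorffMeasure_eq_volume]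
    simp [sq]
  rw [smgDensityLaw, lebesgueOn, image_vecE_spaceT hU hV,
    ← hL.map_euclideanHausdorffMeasure, hvol, Measure.map_map measurable_unvecE hLm,
    withDensity_map (measurable_unvecE.comp hLm) (measurable_smgDensity _ _ _ _).ennreal_ofReal,
    ← Measure.map_map measurable_unvecE hLm]
  congr 1
  have hd : ((fun M ↦ ENNReal.ofReal (smgDensity (U * Uᵀ) (V * Vᵀ) σ R M)) ∘ unvecE ∘
      fun x : EuclideanSpace ℝ (Fin R × Fin R) ↦
        (WithLp.toLp 2 ((V ⊗ₖ U) *ᵥ x.ofLp) : EuclideanSpace ℝ (Fin m₂ × Fin m₁))) = fun x ↦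
      ENNReal.ofReal ((2 * Real.pi * σ ^ 2) ^ (-(Fintype.card (Fin R × Fin R) : ℝ) / 2) *
          Real.exp (-(1 / (2 * σ ^ 2)) * ‖x‖ ^ 2)) := by
    funext x
    simp only [Function.comp_apply]
    rw [← vecE_sandwich, unvecE_vecE, smgDensity_sandwich hU hV]
  rw [hd, withDensity_eq_multivariateGaussian hσ, map_mulVec_multivariateGaussian hS]
  simp [kronecker_mul_transpose_kronecker]

theorem IsSMG.hasLaw_vecE {S : Type*} [MeasurableSpace S] {P : Measure S}
    {X : S → Matrix (Fin m₁) (Fin m₂) ℝ} {σ : ℝ} (hU : Uᵀ * U = 1) (hV : Vᵀ * V = 1)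
    (hX : IsSMG X (U * Uᵀ) (V * Vᵀ) σ R P) :
    HasLaw (fun s ↦ vecE (X s))
      (multivariateGaussian 0 (σ ^ 2 • ((V * Vᵀ) ⊗ₖ (U * Uᵀ)))) P := by
  have hS : (σ ^ 2 • (1 : Matrix (Fin m₂ × Fin m₁) (Fin m₂ × Fin m₁) ℝ)).PosSemidef :=
    PosSemidef.one.smul (sq_nonneg σ)
  refine HasLaw.fun_comp (Y := vecE) ⟨measurable_vecE.aemeasurable, ?_⟩ hX.hasLaw
  have hf : vecE ∘ (fun Z : Matrix (Fin m₁) (Fin m₂) ℝ ↦ U * Uᵀ * Z * (V * Vᵀ)) =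
      (fun x ↦ WithLp.toLp 2 (((V * Vᵀ) ⊗ₖ (U * Uᵀ)) *ᵥ x.ofLp)) ∘ vecE := by
    funext Z
    simpa using vecE_mul_mul (U * Uᵀ) Z (V * Vᵀ)
  rw [Measure.map_map measurable_vecE (measurable_mul_mul _ _), hf,
    ← Measure.map_map (by fun_prop) measurable_vecE, map_vecE_gaussianEnsemble,
    map_mulVec_multivariateGaussian hS]
  congr 1
  -- The covariance is `σ² K Kᵀ` with `K = P_V ⊗ P_U`; it reduces to `σ² K` because `(V ⊗ U)ᵀ (V ⊗
  -- U) = 1`.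
  rw [← kronecker_mul_transpose_kronecker, Matrix.mul_smul, Matrix.mul_one, Matrix.smul_mul,
    transpose_mul, transpose_transpose, Matrix.mul_assoc, ← Matrix.mul_assoc (V ⊗ₖ U)ᵀ,
    transpose_kronecker_mul_kronecker hU hV, Matrix.one_mul]

/-- The law of `vec X` is also the image under `V ⊗ U` of an isotropic Gaussian on `ℝ^(R×R)`, so it
is carried by the range of `V ⊗ U`. That range is closed, hence measurable. -/
theorem IsSMG.ae_mem_spaceT {S : Type*} [MeasurableSpace S] {P : Measure S}
    {X : S → Matrix (Fin m₁) (Fin m₂) ℝ} {σ : ℝ} (hU : Uᵀ * U = 1) (hV : Vᵀ * V = 1)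
    (hX : IsSMG X (U * Uᵀ) (V * Vᵀ) σ R P) :
    ∀ᵐ s ∂P, X s ∈ spaceT (U * Uᵀ) (V * Vᵀ) R := by
  have hS : (σ ^ 2 • (1 : Matrix (Fin R × Fin R) (Fin R × Fin R) ℝ)).PosSemidef :=
    PosSemidef.one.smul (sq_nonneg σ)
  have hL := isometry_mulVec (transpose_kronecker_mul_kronecker hU hV)
  have hlaw := (hX.hasLaw_vecE hU hV).map_eq
  rw [← kronecker_mul_transpose_kronecker, ← Matrix.smul_mul, ← Matrix.mul_one (V ⊗ₖ U),
    ← Matrix.mul_smul, Matrix.mul_one, ← map_mulVec_multivariateGaussian hS] at hlaw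
  have hmem : ∀ᵐ x ∂(P.map fun s ↦ vecE (X s)), x ∈ vecE '' spaceT (U * Uᵀ) (V * Vᵀ) R := by
    rw [image_vecE_spaceT hU hV, hlaw]
    exact (ae_map_iff hL.continuous.measurable.aemeasurable
      hL.isClosedEmbedding.isClosed_range.measurableSet).2
        (Filter.Eventually.of_forall fun x ↦ ⟨x, rfl⟩)
  filter_upwards [ae_of_ae_map (hX.hasLaw_vecE hU hV).aemeasurable hmem] with s hs
  obtain ⟨M, hM, hMX⟩ := hs
  rwa [← unvecE_vecE (X s), ← hMX]

theorem IsSMG.hasLaw_smgDensityLaw {S : Type*} [MeasurableSpace S] {P : Measure S}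
    {X : S → Matrix (Fin m₁) (Fin m₂) ℝ} {σ : ℝ} (hσ : 0 < σ) (hU : Uᵀ * U = 1) (hV : Vᵀ * V = 1)
    (hX : IsSMG X (U * Uᵀ) (V * Vᵀ) σ R P) :
    HasLaw X (smgDensityLaw (U * Uᵀ) (V * Vᵀ) σ R) P := by
  rw [smgDensityLaw_eq_map hU hV hσ]
  exact HasLaw.fun_comp (Y := unvecE) ⟨measurable_unvecE.aemeasurable, rfl⟩ (hX.hasLaw_vecE hU hV)

theorem map_vecE_smgDensityLaw (hU : Uᵀ * U = 1) (hV : Vᵀ * V = 1) {σ : ℝ} (hσ : 0 < σ) :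
    (smgDensityLaw (U * Uᵀ) (V * Vᵀ) σ R).map vecE =
      multivariateGaussian 0 (σ ^ 2 • ((V * Vᵀ) ⊗ₖ (U * Uᵀ))) := by
  rw [smgDensityLaw_eq_map hU hV hσ, Measure.map_map measurable_vecE measurable_unvecE]
  exact Measure.map_id

theorem posSemidef_kronecker_mul_transpose :
    ((V * Vᵀ) ⊗ₖ (U * Uᵀ)).PosSemidef := by
  rw [← kronecker_mul_transpose_kronecker]
  simpa using posSemidef_self_mul_conjTranspose (V ⊗ₖ U)

end Space

/-! ### Conditioning by translation, and the algebra of regression -/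

/-- If `(Y, Z)` has a product law `ν ⊗ ρ`, then the conditional law of `f(Y) + Z` given `Y` is the
translate of `ρ` by `f(Y)`. -/
theorem condDistrib_add_of_hasLaw_prod {S E F : Type*} [MeasurableSpace S] {P : Measure S}
    [IsProbabilityMeasure P] [MeasurableSpace E] [NormedAddCommGroup F] [CompleteSpace F]
    [SecondCountableTopology F] [MeasurableSpace F] [BorelSpace F]
    {Y : S → E} {Z : S → F} {ν : Measure E} {ρ : Measure F} [IsProbabilityMeasure ν]
    [IsProbabilityMeasure ρ] (h : HasLaw (fun s ↦ (Y s, Z s)) (ν.prod ρ) P)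
    {f : E → F} (hf : Measurable f) :
    ∀ᵐ s ∂P, condDistrib (fun s ↦ f (Y s) + Z s) Y P (Y s) = ρ.map (f (Y s) + ·) := by
  have hY : AEMeasurable Y P := h.aemeasurable.fst
  have hZ : AEMeasurable Z P := h.aemeasurable.snd
  have hg : Measurable fun p : E × F ↦ f p.1 + p.2 := by fun_prop
  let κ : Kernel E F := (Kernel.id ×ₖ Kernel.const E ρ).map fun p ↦ f p.1 + p.2
  have hκ (y : E) : κ y = ρ.map (f y + ·) := by
    rw [Kernel.map_apply _ hg, Kernel.prod_apply, Kernel.id_apply, Kernel.const_apply,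
      Measure.dirac_prod, Measure.map_map hg (by fun_prop)]
    rfl
  have : IsMarkovKernel κ := Kernel.IsMarkovKernel.map _ hg
  have hlawY : P.map Y = ν := by
    have := congrArg Measure.fst h.map_eq
    rwa [Measure.fst_prod, Measure.fst_map_prodMk₀ hZ] at this
  -- Disintegrating the joint law along `κ` characterizes the conditional distribution up to a null
  -- set of `Y`-values.
  have hjoint : P.map (fun s ↦ (Y s, f (Y s) + Z s)) = P.map Y ⊗ₘ κ := by
    have hG : Measurable fun p : E × F ↦ (p.1, f p.1 + p.2) := by fun_prop
    have : P.map (fun s ↦ (Y s, f (Y s) + Z s)) =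
        (P.map fun s ↦ (Y s, Z s)).map fun p ↦ (p.1, f p.1 + p.2) := by
      rw [AEMeasurable.map_map_of_aemeasurable hG.aemeasurable h.aemeasurable]
      rfl
    rw [this, h.map_eq, hlawY]
    ext s hs
    rw [Measure.map_apply hG hs, Measure.prod_apply (hG hs), Measure.compProd_apply hs]
    refine lintegral_congr fun y ↦ ?_
    rw [hκ, Measure.map_apply (by fun_prop) (measurable_prodMk_left hs)]
    rfl
  have hae := condDistrib_ae_eq_of_measure_eq_compProd Y (by fun_prop) hjoint
  filter_upwards [ae_of_ae_map hY hae] with s hs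
  rw [hs, hκ]

/-- Turns the blocks of `P_V ⊗ P_U` into products `E K Fᵀ`, so that the regression identity can be
proved for arbitrary `E` and `F`. -/
theorem selector_mul_mul_transpose {ι κ n : Type*} [Fintype n] [DecidableEq n]
    (f : ι → n) (g : κ → n) (K : Matrix n n ℝ) :
    (1 : Matrix n n ℝ).submatrix f id * K * ((1 : Matrix n n ℝ).submatrix g id)ᵀ =
      K.submatrix f g := by
  ext i j
  simp [Matrix.mul_apply, Matrix.one_apply]

/-- The covariance matrix of `(E x + ε, F x - A (E x + ε))` is block diagonal, if `A` is the
regression matrix `(E K Fᵀ)ᵀ (E K Eᵀ + γ² I)⁻¹`. -/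
theorem fromBlocks_conj_eq_fromBlocks {ι κ n : Type*} [Fintype ι] [DecidableEq ι] [Fintype n]
    {K : Matrix n n ℝ} (hK : Kᵀ = K) (E : Matrix ι n ℝ)
    (F : Matrix κ n ℝ) {σ η : ℝ} (hσ : 0 < σ)
    (hu : IsUnit (E * K * Eᵀ + (η ^ 2 / σ ^ 2) • (1 : Matrix ι ι ℝ))) {A : Matrix κ ι ℝ}
    (hA : A = (E * K * Fᵀ)ᵀ * (E * K * Eᵀ + (η ^ 2 / σ ^ 2) • (1 : Matrix ι ι ℝ))⁻¹) :
    fromBlocks E (1 : Matrix ι ι ℝ) (F - A * E) (-A) *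
          fromBlocks (σ ^ 2 • K) 0 0 (η ^ 2 • (1 : Matrix ι ι ℝ)) *
        (fromBlocks E (1 : Matrix ι ι ℝ) (F - A * E) (-A))ᵀ =
      fromBlocks (σ ^ 2 • (E * K * Eᵀ) + η ^ 2 • (1 : Matrix ι ι ℝ)) 0 0
        (σ ^ 2 • (F * K * Fᵀ - A * (E * K * Fᵀ))) := by
  set G := E * K * Eᵀ + (η ^ 2 / σ ^ 2) • (1 : Matrix ι ι ℝ) with hG
  -- The normal equation: it makes the residual uncorrelated with the observations.
  have hAG : A * G = F * K * Eᵀ := by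
    rw [hA, Matrix.mul_assoc, nonsing_inv_mul _ ((isUnit_iff_isUnit_det _).1 hu)]
    simp [hK, Matrix.mul_assoc]
  have hGt : Gᵀ = G := by simp [hG, hK, Matrix.mul_assoc]
  have hGA : G * Aᵀ = E * K * Fᵀ := by
    have := congrArg transpose hAG
    rw [transpose_mul, hGt] at this
    simpa [hK, Matrix.mul_assoc] using this
  -- Eliminates `η`, so that every block is `σ²` times an expression in `G`, `K`, `E`, `F`, `A`.
  have hη : η ^ 2 • (1 : Matrix ι ι ℝ) = σ ^ 2 • (G - E * K * Eᵀ) := by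
    rw [hG, add_sub_cancel_left, smul_smul]
    congr 1
    field_simp
  rw [fromBlocks_transpose, fromBlocks_multiply, fromBlocks_multiply, hη]
  -- Both sides equal `A G Aᵀ`.
  have hFA : F * (K * (Eᵀ * Aᵀ)) = A * (E * (K * Fᵀ)) := by
    rw [← Matrix.mul_assoc K, ← Matrix.mul_assoc F, ← Matrix.mul_assoc F, ← hAG,
      Matrix.mul_assoc A, hGA, Matrix.mul_assoc E]
  congr 1
  · simp
  · simp only [transpose_sub, transpose_mul, transpose_neg, Matrix.mul_zero, add_zero, zero_add,
      Matrix.one_mul, Matrix.mul_sub, Matrix.sub_mul, Matrix.mul_neg, Matrix.mul_smul,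
      Matrix.smul_mul, hGA, Matrix.mul_assoc]
    module
  · simp only [Matrix.mul_zero, add_zero, zero_add, transpose_one,
      Matrix.mul_one, Matrix.mul_sub, Matrix.sub_mul, Matrix.neg_mul, Matrix.mul_smul,
      Matrix.smul_mul, hAG, Matrix.mul_assoc]
    module
  · simp only [transpose_sub, transpose_mul, transpose_neg, Matrix.mul_zero, add_zero, zero_add,
      Matrix.mul_sub, Matrix.sub_mul, Matrix.mul_neg, Matrix.neg_mul, Matrix.mul_smul,
      Matrix.smul_mul, Matrix.mul_assoc, hGA]
    rw [hFA]
    module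

/-! ### Noisy observations and the conditional law -/

section Observation

variable {m₁ m₂ R : ℕ} {PU : Matrix (Fin m₁) (Fin m₁) ℝ} {PV : Matrix (Fin m₂) (Fin m₂) ℝ}
  {Ω : Finset (Fin m₁ × Fin m₂)} {σ η : ℝ}

theorem isUnit_kronObs_add (hK : (PV ⊗ₖ PU).PosSemidef) (hσ : 0 < σ) (hη : 0 < η) :
    IsUnit (kronObs PU PV Ω + (η ^ 2 / σ ^ 2) • (1 : Matrix {p // p ∈ Ω} {p // p ∈ Ω} ℝ)) := by
  refine (PosDef.posSemidef_add (hK.submatrix _) (PosDef.one.smul ?_)).isUnit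
  positivity

theorem kron_fromBlocks (hK : (PV ⊗ₖ PU).PosSemidef) :
    (PV ⊗ₖ PU).submatrix (fun p ↦ (Equiv.sumCompl (· ∈ Ω) p).swap)
        (fun p ↦ (Equiv.sumCompl (· ∈ Ω) p).swap) =
      fromBlocks (kronObs PU PV Ω) (kronCross PU PV Ω) (kronCross PU PV Ω)ᵀ
        (kronUnobs PU PV Ω) := by
  have hsymm : (PV ⊗ₖ PU)ᵀ = PV ⊗ₖ PU := by simpa using hK.1.eq
  ext (i | i) (j | j)
  · rfl
  · rfl
  · exact (congrFun (congrFun hsymm i.1.swap) j.1.swap).symm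
  · rfl

/-- The matrix that sends `(vec X, ε)` to the observations and the regression residual makes the
covariance block diagonal. -/
theorem regression_conj (hK : (PV ⊗ₖ PU).PosSemidef) (hσ : 0 < σ) (hη : 0 < η) :
    ∃ (E : Matrix {p // p ∈ Ω} (Fin m₂ × Fin m₁) ℝ) (F : Matrix {p // p ∉ Ω} (Fin m₂ × Fin m₁) ℝ),
      (∀ M : Matrix (Fin m₁) (Fin m₂) ℝ, E *ᵥ M.vec = fun p ↦ M p.1.1 p.1.2) ∧
      (∀ M : Matrix (Fin m₁) (Fin m₂) ℝ, F *ᵥ M.vec = fun p ↦ M p.1.1 p.1.2) ∧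
      let A := (kronCross PU PV Ω)ᵀ * gainInv PU PV Ω σ η
      let L := fromBlocks E (1 : Matrix {p // p ∈ Ω} {p // p ∈ Ω} ℝ) (F - A * E) (-A)
      L * fromBlocks (σ ^ 2 • (PV ⊗ₖ PU)) 0 0 (η ^ 2 • (1 : Matrix {p // p ∈ Ω} {p // p ∈ Ω} ℝ))
          * Lᵀ =
        fromBlocks (σ ^ 2 • kronObs PU PV Ω + η ^ 2 • (1 : Matrix {p // p ∈ Ω} {p // p ∈ Ω} ℝ))
          0 0 (condCov PU PV Ω σ η) := by
  have hsymm : (PV ⊗ₖ PU)ᵀ = PV ⊗ₖ PU := by simpa using hK.1.eq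
  refine ⟨(1 : Matrix (Fin m₂ × Fin m₁) (Fin m₂ × Fin m₁) ℝ).submatrix (fun p ↦ p.1.swap) id,
    (1 : Matrix (Fin m₂ × Fin m₁) (Fin m₂ × Fin m₁) ℝ).submatrix (fun p ↦ p.1.swap) id,
    fun M ↦ ?_, fun M ↦ ?_, ?_⟩
  · ext p
    simp [mulVec, dotProduct, Matrix.one_apply]
  · ext p
    simp [mulVec, dotProduct, Matrix.one_apply]
  · intro A L
    have := fromBlocks_conj_eq_fromBlocks hsymm
      ((1 : Matrix (Fin m₂ × Fin m₁) (Fin m₂ × Fin m₁) ℝ).submatrix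
        (fun p : {p // p ∈ Ω} ↦ p.1.swap) id)
      ((1 : Matrix (Fin m₂ × Fin m₁) (Fin m₂ × Fin m₁) ℝ).submatrix
        (fun p : {p // p ∉ Ω} ↦ p.1.swap) id) (η := η) (A := A) hσ
      (by rw [selector_mul_mul_transpose]; exact isUnit_kronObs_add hK hσ hη)
      (by rw [selector_mul_mul_transpose, selector_mul_mul_transpose]; rfl)
    simp only [selector_mul_mul_transpose] at this
    exact this

/-- A principal block of `L S Lᵀ`, where `S` is the positive semidefinite covariance of `(vec X,
ε)`: it is the covariance of the residual. -/
theorem posSemidef_condCov (hK : (PV ⊗ₖ PU).PosSemidef) (hσ : 0 < σ) (hη : 0 < η) :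
    (condCov PU PV Ω σ η).PosSemidef := by
  obtain ⟨E, F, -, -, hL⟩ := regression_conj (Ω := Ω) hK hσ hη
  have h := (posSemidef_fromBlocks_zero (hK.smul (sq_nonneg σ))
    ((PosSemidef.one (n := {p // p ∈ Ω}) (R := ℝ)).smul (sq_nonneg η))).mul_mul_conjTranspose_same
      (fromBlocks E 1 (F - (kronCross PU PV Ω)ᵀ * gainInv PU PV Ω σ η * E)
        (-((kronCross PU PV Ω)ᵀ * gainInv PU PV Ω σ η)))
  rw [conjTranspose_eq_transpose_of_trivial, hL] at h
  exact h.submatrix Sum.inr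

/-- The observations and the regression residual of the unobserved entries are independent
Gaussian vectors. -/
theorem IsNoisyObservation.hasLaw_residual {S : Type*} [MeasurableSpace S] {P : Measure S}
    [IsProbabilityMeasure P] {X : S → Matrix (Fin m₁) (Fin m₂) ℝ}
    {Y : S → EuclideanSpace ℝ {p // p ∈ Ω}} (hY : IsNoisyObservation X Ω η Y P)
    (hK : (PV ⊗ₖ PU).PosSemidef) (hσ : 0 < σ) (hη : 0 < η)
    (hX : HasLaw (fun s ↦ vecE (X s)) (multivariateGaussian 0 (σ ^ 2 • (PV ⊗ₖ PU))) P) :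
    HasLaw (fun s ↦ (Y s, unobserved Ω (X s) - condMean PU PV Ω σ η (Y s)))
      ((multivariateGaussian 0 (σ ^ 2 • kronObs PU PV Ω + η ^ 2 • 1)).prod
        (multivariateGaussian 0 (condCov PU PV Ω σ η))) P := by
  obtain ⟨ε, hε, hind, hXε, hYX⟩ := hY
  obtain ⟨E, F, hE, hF, hL⟩ := regression_conj (Ω := Ω) hK hσ hη
  set A := (kronCross PU PV Ω)ᵀ * gainInv PU PV Ω σ η with hA
  have hS := hK.smul (sq_nonneg σ)
  have hT : (η ^ 2 • (1 : Matrix {p // p ∈ Ω} {p // p ∈ Ω} ℝ)).PosSemidef :=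
    PosSemidef.one.smul (sq_nonneg η)
  have hG : (σ ^ 2 • kronObs PU PV Ω + η ^ 2 • 1).PosSemidef :=
    ((hK.submatrix _).smul (sq_nonneg σ)).add hT
  have hlawε : HasLaw (fun s ↦ (WithLp.toLp 2 fun p ↦ ε p s : EuclideanSpace ℝ {p // p ∈ Ω}))
      (multivariateGaussian 0 (η ^ 2 • 1)) P :=
    HasLaw.fun_comp (Y := WithLp.toLp 2)
      ⟨(WithLp.measurable_toLp _ _).aemeasurable, map_toLp_pi_gaussianReal η⟩ (hind.hasLaw_pi hε)
  have hpair := (hXε.comp measurable_vecE (WithLp.measurable_toLp 2 _)).hasLaw_prod hX hlawε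
  have hsum := HasLaw.fun_comp ⟨measurable_toLp_sumElim.aemeasurable,
    map_sumElim_prod_multivariateGaussian hS hT⟩ hpair
  have hlin := HasLaw.fun_comp ⟨by fun_prop, map_mulVec_multivariateGaussian
    (posSemidef_fromBlocks_zero hS hT) (fromBlocks E 1 (F - A * E) (-A))⟩ hsum
  -- Uncorrelated becomes independent: a Gaussian with block-diagonal covariance is a product
  -- measure, up to stacking.
  rw [hL, ← map_sumElim_prod_multivariateGaussian hG (posSemidef_condCov hK hσ hη)] at hlin
  have hsplit : Measurable fun x : EuclideanSpace ℝ ({p // p ∈ Ω} ⊕ {p // p ∉ Ω}) ↦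
      ((WithLp.toLp 2 (x.ofLp ∘ Sum.inl) : EuclideanSpace ℝ {p // p ∈ Ω}),
        (WithLp.toLp 2 (x.ofLp ∘ Sum.inr) : EuclideanSpace ℝ {p // p ∉ Ω})) := by
    refine Measurable.prodMk ?_ ?_ <;>
      exact (WithLp.measurable_toLp _ _).comp (measurable_pi_iff.2 fun i ↦ by
        simp only [Function.comp_apply]; fun_prop)
  have hfin := HasLaw.fun_comp (ν := (multivariateGaussian 0
      (σ ^ 2 • kronObs PU PV Ω + η ^ 2 • 1)).prod (multivariateGaussian 0 (condCov PU PV Ω σ η)))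
    ⟨hsplit.aemeasurable, by
      rw [Measure.map_map hsplit measurable_toLp_sumElim]; exact Measure.map_id⟩ hlin
  convert hfin using 2 with s
  have hY1 : (Y s).ofLp = E *ᵥ (X s).vec + fun p ↦ ε p s := by
    rw [hE]
    funext p
    exact hYX s p
  simp only [fromBlocks_mulVec, Function.comp_def, Sum.elim_inl, Sum.elim_inr, Prod.mk.injEq]
  constructor
  · apply WithLp.ofLp_injective
    rw [hY1, one_mulVec]
    rfl
  · apply WithLp.ofLp_injective
    change _ = (F - A * E) *ᵥ (X s).vec + -A *ᵥ fun p ↦ ε p s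
    rw [WithLp.ofLp_sub, condMean, unobserved, ← hF, ← hA, hY1, mulVec_add, sub_mulVec,
      neg_mulVec, mulVec_mulVec, sub_add_eq_sub_sub, sub_eq_add_neg _ (A *ᵥ _)]

theorem IsNoisyObservation.ae_condDistrib_eq {S : Type*} [MeasurableSpace S] {P : Measure S}
    [IsProbabilityMeasure P] {X : S → Matrix (Fin m₁) (Fin m₂) ℝ}
    {Y : S → EuclideanSpace ℝ {p // p ∈ Ω}} (hY : IsNoisyObservation X Ω η Y P)
    (hK : (PV ⊗ₖ PU).PosSemidef) (hσ : 0 < σ) (hη : 0 < η)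
    (hX : HasLaw (fun s ↦ vecE (X s)) (multivariateGaussian 0 (σ ^ 2 • (PV ⊗ₖ PU))) P) :
    ∀ᵐ s ∂P, condDistrib (fun s ↦ unobserved Ω (X s)) Y P (Y s) =
      multivariateGaussian (condMean PU PV Ω σ η (Y s)) (condCov PU PV Ω σ η) := by
  have hf : Measurable (condMean PU PV Ω σ η) := by
    unfold condMean
    fun_prop
  have h := condDistrib_add_of_hasLaw_prod (hY.hasLaw_residual hK hσ hη hX) hf
  -- With `f` the conditional mean and `Z` the residual, `f(Y) + Z` is the unobserved vector itself.
  simp only [add_sub_cancel] at h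
  filter_upwards [h] with s hs
  rw [hs, map_add_multivariateGaussian]

end Observation

end MatrixCompletion

theorem mainTheorem7 {S : Type*} [MeasurableSpace S] (P : Measure S) [IsProbabilityMeasure P]
    (m₁ m₂ R : ℕ) (PU : Matrix (Fin m₁) (Fin m₁) ℝ) (PV : Matrix (Fin m₂) (Fin m₂) ℝ)
    (σ : ℝ) (hσ : 0 < σ) (X : S → Matrix (Fin m₁) (Fin m₂) ℝ)
    (hX : MatrixCompletion.IsSMG X PU PV σ R P) :
    -- (a) the space `T`, the density on it, and the degenerate Gaussian law of `vec X`
    ((∃ W : Submodule ℝ (Matrix (Fin m₁) (Fin m₂) ℝ),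
        (W : Set (Matrix (Fin m₁) (Fin m₂) ℝ)) = MatrixCompletion.spaceT PU PV R ∧
        Module.finrank ℝ W = R ^ 2) ∧
      (∀ᵐ s ∂P, X s ∈ MatrixCompletion.spaceT PU PV R) ∧
      HasLaw X (MatrixCompletion.smgDensityLaw PU PV σ R) P ∧
      (σ ^ 2 • (PV ⊗ₖ PU)).PosSemidef ∧
      HasLaw (fun s ↦ MatrixCompletion.vecE (X s))
        (multivariateGaussian 0 (σ ^ 2 • (PV ⊗ₖ PU))) P ∧
      (MatrixCompletion.smgDensityLaw PU PV σ R).map MatrixCompletion.vecE =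
        multivariateGaussian 0 (σ ^ 2 • (PV ⊗ₖ PU))) ∧
    -- (b) the law of the unobserved entries given the noisy observations
    (∀ (Ω : Finset (Fin m₁ × Fin m₂)) (η : ℝ), 0 < η →
      ∀ Y : S → EuclideanSpace ℝ {p // p ∈ Ω}, MatrixCompletion.IsNoisyObservation X Ω η Y P →
        (PV ⊗ₖ PU).submatrix (fun p ↦ (Equiv.sumCompl (· ∈ Ω) p).swap)
            (fun p ↦ (Equiv.sumCompl (· ∈ Ω) p).swap) =
          Matrix.fromBlocks (MatrixCompletion.kronObs PU PV Ω) (MatrixCompletion.kronCross PU PV Ω)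
            (MatrixCompletion.kronCross PU PV Ω)ᵀ (MatrixCompletion.kronUnobs PU PV Ω) ∧
        IsUnit (MatrixCompletion.kronObs PU PV Ω +
          (η ^ 2 / σ ^ 2) • (1 : Matrix {p // p ∈ Ω} {p // p ∈ Ω} ℝ)) ∧
        (MatrixCompletion.condCov PU PV Ω σ η).PosSemidef ∧
        ∀ᵐ s ∂P, condDistrib (fun s ↦ MatrixCompletion.unobserved Ω (X s)) Y P (Y s) =
          multivariateGaussian (MatrixCompletion.condMean PU PV Ω σ η (Y s))
            (MatrixCompletion.condCov PU PV Ω σ η)) := by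
  obtain ⟨U, hU, rfl⟩ := hX.left_proj
  obtain ⟨V, hV, rfl⟩ := hX.right_proj
  have hK := MatrixCompletion.posSemidef_kronecker_mul_transpose (U := U) (V := V)
  have hlaw := hX.hasLaw_vecE hU hV
  refine ⟨⟨⟨_, MatrixCompletion.range_sandwich hU hV,
      MatrixCompletion.finrank_range_sandwich hU hV⟩, hX.ae_mem_spaceT hU hV,
    hX.hasLaw_smgDensityLaw hσ hU hV, hK.smul (sq_nonneg σ), hlaw,
    MatrixCompletion.map_vecE_smgDensityLaw hU hV hσ⟩, fun Ω η hη Y hY ↦ ?_⟩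
  exact ⟨MatrixCompletion.kron_fromBlocks hK, MatrixCompletion.isUnit_kronObs_add hK hσ hη,
    MatrixCompletion.posSemidef_condCov hK hσ hη, hY.ae_condDistrib_eq hK hσ hη hlaw⟩
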